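/- Let $\mathbb K$ be $\mathbb R$ or $\mathbb C$, let $n$ be a natural number and let $E$ be a Banach space over $\mathbb K$ with bidual $E''$. Let $\mathcal P^n(E)$ be the space of continuous scalar-valued $n$-homogeneous polynomials on $E$. The Aron--Berner extension $AB(P)\in\mathcal P^n(E'')$ of $P\in\mathcal P^n(E)$ with associated symmetric $n$-linear form $A$ is $AB(P)(z)=\widetilde A(z,\dots,z)$, where $\widetilde A$ is obtained from $A$ by extending the variables to $E''$ one after the other, from the last to the first, by weak-star continuity: $$\widetilde A(z_1,\dots,z_n)=z_1\bigl(x_1\mapsto z_2\bigl(x_2\mapsto\cdots z_n(x_n\mapsto A(x_1,\dots,x_n))\cdots\bigr)\bigr).$$ Let $\otimes^{n,s}E$ be the $n$-fold symmetric tensor product, the linear span of the powers $\otimes^n x=x\otimes\cdots\otimes x$ in $\otimes^nE$. An s-tensor norm $\alpha$ of order $n$ assigns to every Banach space $E$ a norm $\alpha(\cdot\,;\otimes^{n,s}E)$ on $\otimes^{n,s}E$ such that $\varepsilon_s\le\alpha\le\pi_s$ (the injective and the projective s-tensor norm) and $\alpha(\otimes^{n,s}T(z);\otimes^{n,s}F)\le\|T\|^n\,\alpha(z;\otimes^{n,s}E)$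 for all bounded operators $T:E\to F$ and $z\in\otimes^{n,s}E$. It is finitely generated if $\alpha(z;\otimes^{n,s}E)=\inf\{\alpha(z;\otimes^{n,s}M): M\subset E \text{ a finite-dimensional subspace},\ z\in\otimes^{n,s}M\}$ for all $E$ and $z$. Let $\widetilde\otimes^{n,s}_\alpha E$ be the completion; a functional $\varphi\in(\widetilde\otimes^{n,s}_\alpha E)'$ is identified with the polynomial $x\mapsto\varphi(\otimes^n x)$ in $\mathcal P^n(E)$. A Banach ideal $\mathcal Q$ of $n$-homogeneous polynomials assigns to every Banach space $E$ a linear subspace $\mathcal Q(E)$ of $\mathcal P^n(E)$ with a complete norm $\|\cdot\|_{\mathcal Q(E)}$ such that $P\circ T\in\mathcal Q(F)$ and $\|P\circ T\|_{\mathcal Q(F)}\le\|P\|_{\mathcal Q(E)}\|T\|^n$ for all $P\in\mathcal Q(E)$ and bounded operators $T:F\to E$, and such that $z\mapsto z^n$ belongs to $\mathcal Q(\mathbb K)$ with norm $1$. It is maximal if, for all $E$ and $P\in\mathcal P^n(E)$, one has $P\in\mathcal Q(E)$ if and only if $s(P):=\sup\{\|P|_M\|_{\mathcal Q(M)}: M\subset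 E \text{ a finite-dimensional subspace}\}<\infty$, and in that case $\|P\|_{\mathcal Q(E)}=s(P)$. Then the following hold. (a) Let $\alpha$ be a finitely generated s-tensor norm of order $n$ and let $P\in(\widetilde\otimes^{n,s}_\alpha E)'$. Then $AB(P)\in(\widetilde\otimes^{n,s}_\alpha E'')'$ and $$\|P\|_{(\widetilde\otimes^{n,s}_\alpha E)'}=\|AB(P)\|_{(\widetilde\otimes^{n,s}_\alpha E'')'}.$$ (b) Let $\mathcal Q$ be a maximal Banach ideal of $n$-homogeneous polynomials and let $P\in\mathcal Q(E)$. Then $AB(P)\in\mathcal Q(E'')$ and $$\|P\|_{\mathcal Q(E)}=\|AB(P)\|_{\mathcal Q(E'')}.$$ Thus the linear map $AB$ is an isometry from $\mathcal Q(E)$ into $\mathcal Q(E'')$. -/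

import Mathlib

open scoped TensorProduct ENNReal
open Filter Topology

universe u

noncomputable section

/-! ### Polarization -/

/-- The polarization identity for the sum of all permutations of a multilinear map. -/
theorem polarization_identity {R V W : Type*} [CommRing R] [AddCommGroup V] [Module R V]
    [AddCommGroup W] [Module R W] {n : ℕ}
    (f : MultilinearMap R (fun _ : Fin n => V) W) (x : Fin n → V) :
    ∑ σ : Equiv.Perm (Fin n), f (fun i => x (σ i)) =
      ∑ T : Finset (Fin n), (-1 : ℤ) ^ T.card • f (fun _ => ∑ i ∈ Tᶜ, x i) := by
  classical
  have h1 : ∀ T : Finset (Fin n), f (fun _ => ∑ i ∈ Tᶜ, x i) =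
      ∑ r : Fin n → Fin n, if T ⊆ (Finset.univ.image r)ᶜ then f (fun i => x (r i)) else 0 := by
    intro T
    rw [f.map_sum_finset (fun _ j => x j) (fun _ => Tᶜ), ← Finset.sum_filter]
    refine Finset.sum_congr ?_ fun _ _ => rfl
    ext r
    simp only [Fintype.mem_piFinset, Finset.mem_compl, Finset.mem_filter, Finset.mem_univ,
      true_and, Finset.subset_iff, Finset.mem_image]
    grind
  have h2 : ∀ r : Fin n → Fin n,
      ∑ T : Finset (Fin n), (-1 : ℤ) ^ T.card •
        (if T ⊆ (Finset.univ.image r)ᶜ then f (fun i => x (r i)) else 0) =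
      if Function.Bijective r then f (fun i => x (r i)) else 0 := by
    intro r
    have h3 : ∑ T : Finset (Fin n), (-1 : ℤ) ^ T.card •
        (if T ⊆ (Finset.univ.image r)ᶜ then f (fun i => x (r i)) else 0) =
        (∑ T ∈ ((Finset.univ.image r)ᶜ).powerset, (-1 : ℤ) ^ T.card) • f (fun i => x (r i)) := by
      rw [Finset.sum_smul]
      simp_rw [smul_ite, smul_zero]
      rw [← Finset.sum_filter]
      refine Finset.sum_congr ?_ fun _ _ => rfl
      ext T
      simp
    rw [h3, Finset.sum_powerset_neg_one_pow_card]
    have h4 : (Finset.univ.image r)ᶜ = ∅ ↔ Function.Bijective r := by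
      rw [← Finite.surjective_iff_bijective, Finset.compl_eq_empty_iff,
        ← Finset.coe_eq_univ, Finset.coe_image,
        Finset.coe_univ, Set.image_univ, Set.range_eq_univ]
    simp only [h4]
    split_ifs <;> simp
  simp_rw [h1, Finset.smul_sum]
  rw [Finset.sum_comm]
  simp_rw [h2]
  rw [← Finset.sum_filter]
  refine Finset.sum_bij (fun σ _ => (σ : Fin n → Fin n)) ?_ ?_ ?_ ?_
  · intro σ _
    exact Finset.mem_filter.mpr ⟨Finset.mem_univ _, σ.bijective⟩
  · intro σ _ τ _ h
    exact Equiv.coe_fn_injective h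
  · intro r hr
    exact ⟨Equiv.ofBijective r (Finset.mem_filter.mp hr).2, Finset.mem_univ _, rfl⟩
  · intro _ _
    rfl

/-! ### Continuous homogeneous polynomials -/

section Polynomials

variable (𝕜 : Type*) [RCLike 𝕜] (n : ℕ) (E : Type*) [NormedAddCommGroup E] [NormedSpace 𝕜 E]

/-- `x ↦ A (x, …, x)`, as a linear map of the continuous `n`-linear form `A`. -/
def diagonalMap : (E [×n]→L[𝕜] 𝕜) →ₗ[𝕜] (E → 𝕜) where
  toFun A x := A (fun _ => x)
  map_add' _ _ := rfl
  map_smul' _ _ := rfl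

/-- The space `𝒫ⁿ(E)` of continuous scalar valued `n`-homogeneous polynomials on `E`. -/
def HomPoly : Submodule 𝕜 (E → 𝕜) := LinearMap.range (diagonalMap 𝕜 n E)

variable {𝕜 n E}

/-- The symmetrization of a continuous `n`-linear form. -/
def symmetrize (A : E [×n]→L[𝕜] 𝕜) : E [×n]→L[𝕜] 𝕜 :=
  ((n.factorial : 𝕜)⁻¹) • ∑ σ : Equiv.Perm (Fin n), A.domDomCongr σ

theorem symmetrize_apply (A : E [×n]→L[𝕜] 𝕜) (x : Fin n → E) :
    symmetrize A x = (n.factorial : 𝕜)⁻¹ * ∑ T : Finset (Fin n),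
      (-1 : ℤ) ^ T.card • A (fun _ => ∑ i ∈ Tᶜ, x i) := by
  have h := polarization_identity A.toMultilinearMap x
  simp only [ContinuousMultilinearMap.coe_coe] at h
  rw [← h]
  simp [symmetrize, _root_.sum_apply]

/-- The symmetric continuous `n`-linear form associated with an `n`-homogeneous polynomial. -/
def HomPoly.symForm (P : HomPoly 𝕜 n E) : E [×n]→L[𝕜] 𝕜 := symmetrize P.2.choose

theorem HomPoly.symForm_apply (P : HomPoly 𝕜 n E) (x : Fin n → E) :
    HomPoly.symForm P x = (n.factorial : 𝕜)⁻¹ * ∑ T : Finset (Fin n),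
      (-1 : ℤ) ^ T.card • P.1 (∑ i ∈ Tᶜ, x i) := by
  have h : ∀ y, P.2.choose (fun _ => y) = P.1 y := fun y => congrFun P.2.choose_spec y
  simp only [HomPoly.symForm, symmetrize_apply, h]

/-- The associated form is symmetric. -/
theorem HomPoly.symForm_perm (P : HomPoly 𝕜 n E) (τ : Equiv.Perm (Fin n)) (x : Fin n → E) :
    HomPoly.symForm P (fun i => x (τ i)) = HomPoly.symForm P x := by
  simp only [HomPoly.symForm, symmetrize, _root_.smul_apply,
    _root_.sum_apply, ContinuousMultilinearMap.domDomCongr_apply]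
  congr 1
  exact Fintype.sum_equiv (Equiv.mulLeft τ) _ _ fun σ => rfl

/-- The associated form gives back the polynomial on the diagonal. -/
theorem HomPoly.symForm_diag (P : HomPoly 𝕜 n E) (x : E) :
    HomPoly.symForm P (fun _ => x) = P.1 x := by
  have h : P.2.choose (fun _ => x) = P.1 x := congrFun P.2.choose_spec x
  have h0 : (n.factorial : 𝕜) ≠ 0 := Nat.cast_ne_zero.mpr n.factorial_ne_zero
  simp [HomPoly.symForm, symmetrize, _root_.sum_apply, h, Fintype.card_perm, h0]

/-- `P ∘ T` for a continuous linear operator `T`. -/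
def HomPoly.comp {F : Type*} [NormedAddCommGroup F] [NormedSpace 𝕜 F]
    (P : HomPoly 𝕜 n E) (T : F →L[𝕜] E) : HomPoly 𝕜 n F :=
  ⟨fun y => P.1 (T y), by
    obtain ⟨A, hA⟩ := P.2
    exact ⟨A.compContinuousLinearMap fun _ => T, by rw [← hA]; rfl⟩⟩

variable (𝕜 n) in
/-- The polynomial `z ↦ zⁿ` on the scalar field. -/
def HomPoly.pow : HomPoly 𝕜 n 𝕜 :=
  ⟨fun z => z ^ n, ContinuousMultilinearMap.mkPiAlgebraFin 𝕜 n 𝕜, by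
    funext z
    simp [diagonalMap]⟩

end Polynomials

/-! ### The Aron–Berner extension -/

section AronBerner

variable {𝕜 : Type*} [RCLike 𝕜] {E : Type*} [NormedAddCommGroup E] [NormedSpace 𝕜 E]

variable (𝕜 E) in
/-- The bidual `E''`. -/
abbrev Bidual : Type _ := StrongDual 𝕜 (StrongDual 𝕜 E)

/-- The iterated extension of an `n`-linear form to the bidual. The last variable is extended
first: for fixed `x₁, …, xₙ₋₁` the functional `A (x₁, …, xₙ₋₁, ·)` extends in a unique weak-star
continuous way to `E''`, with value `zₙ (A (x₁, …, xₙ₋₁, ·))` at `zₙ`; one proceeds in the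
same way with the resulting `(n - 1)`-linear form, down to the first variable. -/
def aronBernerVal : (n : ℕ) → (E [×n]→L[𝕜] 𝕜) → (Fin n → Bidual 𝕜 E) → 𝕜
  | 0, A, _ => A 0
  | n + 1, A, z =>
      aronBernerVal n ((z (Fin.last n)).compContinuousMultilinearMap A.curryRight) (Fin.init z)

theorem aronBernerVal_add : ∀ (n : ℕ) (A B : E [×n]→L[𝕜] 𝕜) (z : Fin n → Bidual 𝕜 E),
    aronBernerVal n (A + B) z = aronBernerVal n A z + aronBernerVal n B z
  | 0, _, _, _ => rfl
  | n + 1, A, B, z => by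
      simp only [aronBernerVal]
      rw [← aronBernerVal_add n]
      congr 1
      ext m
      exact map_add (z (Fin.last n)) (A.curryRight m) (B.curryRight m)

theorem aronBernerVal_smul : ∀ (n : ℕ) (c : 𝕜) (A : E [×n]→L[𝕜] 𝕜) (z : Fin n → Bidual 𝕜 E),
    aronBernerVal n (c • A) z = c * aronBernerVal n A z
  | 0, _, _, _ => rfl
  | n + 1, c, A, z => by
      simp only [aronBernerVal]
      rw [← aronBernerVal_smul n]
      congr 1
      ext m
      exact map_smul (z (Fin.last n)) c (A.curryRight m)

theorem aronBernerVal_norm_le : ∀ (n : ℕ) (A : E [×n]→L[𝕜] 𝕜) (z : Fin n → Bidual 𝕜 E),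
    ‖aronBernerVal n A z‖ ≤ ‖A‖ * ∏ i, ‖z i‖
  | 0, A, z => by
      simp [aronBernerVal]
  | n + 1, A, z => by
      simp only [aronBernerVal]
      refine (aronBernerVal_norm_le n _ _).trans ?_
      have h := (z (Fin.last n)).norm_compContinuousMultilinearMap_le A.curryRight
      rw [A.curryRight_norm] at h
      rw [Fin.prod_univ_castSucc]
      calc _ ≤ (‖z (Fin.last n)‖ * ‖A‖) * ∏ i, ‖Fin.init z i‖ := by gcongr
        _ = _ := by simp only [Fin.init]; ring

theorem aronBernerVal_update_add : ∀ (n : ℕ) (A : E [×n]→L[𝕜] 𝕜) (z : Fin n → Bidual 𝕜 E)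
    (i : Fin n) (a b : Bidual 𝕜 E), aronBernerVal n A (Function.update z i (a + b)) =
      aronBernerVal n A (Function.update z i a) + aronBernerVal n A (Function.update z i b)
  | 0, _, _, i, _, _ => i.elim0
  | n + 1, A, z, i, a, b => by
      simp only [aronBernerVal]
      induction i using Fin.lastCases with
      | last =>
          simp only [Function.update_self, Fin.init_update_last]
          rw [← aronBernerVal_add]
          rfl
      | cast j =>
          simp only [Fin.init_update_castSucc, ne_eq, (Fin.castSucc_lt_last _).ne', not_false_eq_true,
            Function.update_of_ne]
          exact aronBernerVal_update_add n _ _ j a b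

theorem aronBernerVal_update_smul : ∀ (n : ℕ) (A : E [×n]→L[𝕜] 𝕜) (z : Fin n → Bidual 𝕜 E)
    (i : Fin n) (c : 𝕜) (a : Bidual 𝕜 E), aronBernerVal n A (Function.update z i (c • a)) =
      c • aronBernerVal n A (Function.update z i a)
  | 0, _, _, i, _, _ => i.elim0
  | n + 1, A, z, i, c, a => by
      simp only [aronBernerVal]
      induction i using Fin.lastCases with
      | last =>
          simp only [Function.update_self, Fin.init_update_last]
          rw [smul_eq_mul, ← aronBernerVal_smul]
          rfl
      | cast j =>
          simp only [Fin.init_update_castSucc, ne_eq, (Fin.castSucc_lt_last _).ne', not_false_eq_true,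
            Function.update_of_ne]
          exact aronBernerVal_update_smul n _ _ j c a

/-- The iterated extension as an `n`-linear form on `E''`. -/
def aronBernerMultilinear {n : ℕ} (A : E [×n]→L[𝕜] 𝕜) :
    MultilinearMap 𝕜 (fun _ : Fin n => Bidual 𝕜 E) 𝕜 where
  toFun := aronBernerVal n A
  map_update_add' := by
    intro inst z i a b
    rw [Subsingleton.elim inst (instDecidableEqFin n)]
    exact aronBernerVal_update_add n A z i a b
  map_update_smul' := by
    intro inst z i c a
    rw [Subsingleton.elim inst (instDecidableEqFin n)]
    exact aronBernerVal_update_smul n A z i c a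

/-- The iterated extension as a continuous `n`-linear form on `E''`. -/
def aronBernerForm {n : ℕ} (A : E [×n]→L[𝕜] 𝕜) : Bidual 𝕜 E [×n]→L[𝕜] 𝕜 :=
  MultilinearMap.mkContinuous (𝕜 := 𝕜) (E := fun _ : Fin n => Bidual 𝕜 E) (G := 𝕜)
    (aronBernerMultilinear A) ‖A‖ (aronBernerVal_norm_le n A)

/-- The Aron–Berner extension `AB : 𝒫ⁿ(E) → 𝒫ⁿ(E'')`: extend the associated symmetric form and
restrict to the diagonal. -/
def aronBerner {n : ℕ} : HomPoly 𝕜 n E →ₗ[𝕜] HomPoly 𝕜 n (Bidual 𝕜 E) where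
  toFun P := ⟨fun z => aronBernerForm (HomPoly.symForm P) (fun _ => z),
    aronBernerForm (HomPoly.symForm P), rfl⟩
  map_add' P Q := by
    have h : HomPoly.symForm (P + Q) = HomPoly.symForm P + HomPoly.symForm Q := by
      ext x
      simp only [HomPoly.symForm_apply, _root_.add_apply, Submodule.coe_add,
        Pi.add_apply, smul_add, Finset.sum_add_distrib, mul_add]
    refine Subtype.ext (funext fun z => ?_)
    change aronBernerVal n (HomPoly.symForm (P + Q)) (fun _ => z) = _
    rw [h]
    exact aronBernerVal_add n (HomPoly.symForm P) (HomPoly.symForm Q) fun _ => z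
  map_smul' c P := by
    have h : HomPoly.symForm (c • P) = c • HomPoly.symForm P := by
      ext x
      simp only [HomPoly.symForm_apply, _root_.smul_apply, Submodule.coe_smul,
        Pi.smul_apply, smul_eq_mul, Finset.mul_sum]
      refine Finset.sum_congr rfl fun T _ => ?_
      simp only [zsmul_eq_mul]
      ring
    refine Subtype.ext (funext fun z => ?_)
    change aronBernerVal n (HomPoly.symForm (c • P)) (fun _ => z) = _
    rw [h]
    exact aronBernerVal_smul n c (HomPoly.symForm P) fun _ => z

end AronBerner

/-! ### Symmetric tensor products and s-tensor norms -/

section SymTensor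

variable (𝕜 : Type*) [RCLike 𝕜] (n : ℕ) (E : Type*) [NormedAddCommGroup E] [NormedSpace 𝕜 E]

/-- The `n`-fold symmetric tensor product of `E`: the subspace of the `n`-fold tensor product
spanned by the powers `x ⊗ ⋯ ⊗ x`. -/
def SymTensor : Submodule 𝕜 (⨂[𝕜] _ : Fin n, E) :=
  Submodule.span 𝕜 (Set.range fun x : E => PiTensorProduct.tprod 𝕜 fun _ : Fin n => x)

variable {𝕜 E}

variable (𝕜) in
/-- The power `x ⊗ ⋯ ⊗ x`. -/
def tensorPow (x : E) : SymTensor 𝕜 n E :=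
  ⟨PiTensorProduct.tprod 𝕜 fun _ : Fin n => x, Submodule.subset_span ⟨x, rfl⟩⟩

/-- The operator `T ⊗ ⋯ ⊗ T` between symmetric tensor products. -/
def symTensorMap {F : Type*} [NormedAddCommGroup F] [NormedSpace 𝕜 F] (T : E →L[𝕜] F) :
    SymTensor 𝕜 n E →ₗ[𝕜] SymTensor 𝕜 n F :=
  (PiTensorProduct.map fun _ : Fin n => (T : E →ₗ[𝕜] F)).restrict (by
    change SymTensor 𝕜 n E ≤ (SymTensor 𝕜 n F).comap _
    refine Submodule.span_le.mpr ?_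
    rintro _ ⟨x, rfl⟩
    simp only [Submodule.comap_coe, Set.mem_preimage, SetLike.mem_coe, PiTensorProduct.map_tprod]
    exact Submodule.subset_span ⟨T x, rfl⟩)

variable {n}

/-- The injective s-tensor norm: the supremum of the moduli of the values at `z` of the functionals
`φ ⊗ ⋯ ⊗ φ`, over the closed unit ball of `E'`. -/
def injectiveSNorm (z : SymTensor 𝕜 n E) : ℝ :=
  ⨆ φ : Metric.closedBall (0 : StrongDual 𝕜 E) 1,
    ‖PiTensorProduct.lift
      ((MultilinearMap.mkPiAlgebra 𝕜 (Fin n) 𝕜).compLinearMap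
        fun _ => ((φ : StrongDual 𝕜 E) : E →ₗ[𝕜] 𝕜)) (z : ⨂[𝕜] _ : Fin n, E)‖

/-- The projective s-tensor norm: the infimum of `∑ |λⱼ| ‖xⱼ‖ⁿ` over all finite representations
`z = ∑ λⱼ xⱼ ⊗ ⋯ ⊗ xⱼ`. -/
def projectiveSNorm (z : SymTensor 𝕜 n E) : ℝ :=
  sInf {r : ℝ | ∃ (k : ℕ) (c : Fin k → 𝕜) (x : Fin k → E),
    z = ∑ j, c j • tensorPow 𝕜 n (x j) ∧ r = ∑ j, ‖c j‖ * ‖x j‖ ^ n}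

theorem projectiveSNorm_tensorPow_le (x : E) : projectiveSNorm (tensorPow 𝕜 n x) ≤ ‖x‖ ^ n := by
  refine csInf_le ⟨0, ?_⟩ ⟨1, fun _ => 1, fun _ => x, by simp, by simp⟩
  rintro _ ⟨k, c, y, -, rfl⟩
  positivity

variable (𝕜 n E) in
/-- The symmetric product `x₁ ∨ ⋯ ∨ xₙ = (1 / n!) ∑ x_σ(1) ⊗ ⋯ ⊗ x_σ(n)`. -/
def symProd : MultilinearMap 𝕜 (fun _ : Fin n => E) (SymTensor 𝕜 n E) :=
  ((n.factorial : 𝕜)⁻¹ • ∑ σ : Equiv.Perm (Fin n),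
    (PiTensorProduct.tprod 𝕜 : MultilinearMap 𝕜 (fun _ : Fin n => E) _).domDomCongr σ).codRestrict
    (SymTensor 𝕜 n E) (by
      intro x
      simp only [_root_.smul_apply, _root_.sum_apply,
        MultilinearMap.domDomCongr_apply]
      rw [polarization_identity]
      refine Submodule.smul_mem _ _ (Submodule.sum_mem _ fun T _ => ?_)
      exact zsmul_mem (Submodule.subset_span (Set.mem_range_self (∑ i ∈ Tᶜ, x i))) _)

theorem symProd_apply (x : Fin n → E) : symProd 𝕜 n E x =
    (n.factorial : 𝕜)⁻¹ • ∑ T : Finset (Fin n),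
      (-1 : ℤ) ^ T.card • tensorPow 𝕜 n (∑ i ∈ Tᶜ, x i) := by
  apply Subtype.ext
  have h := polarization_identity
    (PiTensorProduct.tprod 𝕜 : MultilinearMap 𝕜 (fun _ : Fin n => E) _) x
  simp only [symProd, MultilinearMap.codRestrict_apply_coe, _root_.smul_apply,
    _root_.sum_apply, MultilinearMap.domDomCongr_apply, h, Submodule.coe_smul,
    AddSubmonoidClass.coe_finsetSum, AddSubgroupClass.coe_zsmul, tensorPow]

theorem symProd_diag (x : E) : symProd 𝕜 n E (fun _ => x) = tensorPow 𝕜 n x := by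
  apply Subtype.ext
  have h0 : (n.factorial : 𝕜) ≠ 0 := Nat.cast_ne_zero.mpr n.factorial_ne_zero
  simp only [symProd, MultilinearMap.codRestrict_apply_coe, _root_.smul_apply,
    _root_.sum_apply, MultilinearMap.domDomCongr_apply, tensorPow, Finset.sum_const,
    Finset.card_univ, Fintype.card_perm, Fintype.card_fin]
  rw [← Nat.cast_smul_eq_nsmul 𝕜, smul_smul, inv_mul_cancel₀ h0, one_smul]

end SymTensor

/-- An s-tensor norm of order `n` on the class of Banach spaces: a norm on the `n`-fold symmetric
tensor product of every Banach space, between the injective and the projective one, with the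
metric mapping property. -/
structure STensorNorm (𝕜 : Type u) [RCLike 𝕜] (n : ℕ) where
  norm : ∀ (E : Type u) [NormedAddCommGroup E] [NormedSpace 𝕜 E] [CompleteSpace E],
    Seminorm 𝕜 (SymTensor 𝕜 n E)
  eq_zero_of_norm_eq_zero : ∀ (E : Type u) [NormedAddCommGroup E] [NormedSpace 𝕜 E]
    [CompleteSpace E] (z : SymTensor 𝕜 n E), norm E z = 0 → z = 0
  injective_le : ∀ (E : Type u) [NormedAddCommGroup E] [NormedSpace 𝕜 E] [CompleteSpace E]
    (z : SymTensor 𝕜 n E), injectiveSNorm z ≤ norm E z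
  le_projective : ∀ (E : Type u) [NormedAddCommGroup E] [NormedSpace 𝕜 E] [CompleteSpace E]
    (z : SymTensor 𝕜 n E), norm E z ≤ projectiveSNorm z
  norm_map_le : ∀ (E F : Type u) [NormedAddCommGroup E] [NormedSpace 𝕜 E] [CompleteSpace E]
    [NormedAddCommGroup F] [NormedSpace 𝕜 F] [CompleteSpace F] (T : E →L[𝕜] F)
    (z : SymTensor 𝕜 n E), norm F (symTensorMap n T z) ≤ ‖T‖ ^ n * norm E z

namespace STensorNorm

variable {𝕜 : Type u} [RCLike 𝕜] {n : ℕ}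

/-- `α` is finitely generated: `α(z; ⊗E)` is the infimum of `α(w; ⊗M)` over all finite dimensional
subspaces `M` of `E` whose symmetric tensor product contains `z`, that is, `z` is the
image of some `w` under the map induced by the inclusion of `M`. -/
def FinitelyGenerated (α : STensorNorm 𝕜 n) : Prop :=
  ∀ (E : Type u) [NormedAddCommGroup E] [NormedSpace 𝕜 E] [CompleteSpace E]
    (z : SymTensor 𝕜 n E),
    IsGLB {r : ℝ | ∃ (M : Submodule 𝕜 E) (_ : FiniteDimensional 𝕜 M) (w : SymTensor 𝕜 n M),
      symTensorMap n M.subtypeL w = z ∧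
        r = haveI := FiniteDimensional.complete 𝕜 M; α.norm M w} (α.norm E z)

variable (α : STensorNorm 𝕜 n) (E : Type u) [NormedAddCommGroup E] [NormedSpace 𝕜 E]
  [CompleteSpace E]

/-- The symmetric tensor product of `E`, to be normed by `α`. -/
def Space (_ : STensorNorm 𝕜 n) (E : Type u) [NormedAddCommGroup E] [NormedSpace 𝕜 E]
    [CompleteSpace E] : Type u := SymTensor 𝕜 n E

instance : AddCommGroup (α.Space E) := inferInstanceAs (AddCommGroup (SymTensor 𝕜 n E))

instance : Module 𝕜 (α.Space E) := inferInstanceAs (Module 𝕜 (SymTensor 𝕜 n E))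

instance : NormedAddCommGroup (α.Space E) :=
  AddGroupNorm.toNormedAddCommGroup
    { toFun := fun z : SymTensor 𝕜 n E => α.norm E z
      map_zero' := map_zero (α.norm E)
      add_le' := map_add_le_add (α.norm E)
      neg' := map_neg_eq_map (α.norm E)
      eq_zero_of_map_eq_zero' := α.eq_zero_of_norm_eq_zero E }

instance : NormedSpace 𝕜 (α.Space E) where
  norm_smul_le c z := (map_smul_eq_mul (α.norm E) c z).le

/-- The completion of the symmetric tensor product of `E` normed by `α`. -/
abbrev Completion : Type u := UniformSpace.Completion (α.Space E)

variable {E}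

/-- The power `x ⊗ ⋯ ⊗ x` as an element of the completed symmetric tensor product. -/
def pow (x : E) : α.Completion E :=
  UniformSpace.Completion.coe' (α := α.Space E) (tensorPow 𝕜 n x)

variable {α}

/-- The `n`-linear form on `E` given by a functional on the completed symmetric tensor product. -/
def dualFormAux (φ : StrongDual 𝕜 (α.Completion E)) :
    MultilinearMap 𝕜 (fun _ : Fin n => E) 𝕜 :=
  (φ.comp (UniformSpace.Completion.toComplL : α.Space E →L[𝕜] α.Completion E)).toLinearMap
    |>.compMultilinearMap (symProd 𝕜 n E : MultilinearMap 𝕜 (fun _ : Fin n => E) (α.Space E))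

theorem norm_pow_le (x : E) : ‖α.pow x‖ ≤ ‖x‖ ^ n := by
  have h : ‖α.pow x‖ = α.norm E (tensorPow 𝕜 n x) :=
    UniformSpace.Completion.norm_coe (E := α.Space E) (tensorPow 𝕜 n x)
  rw [h]
  exact (α.le_projective E _).trans (projectiveSNorm_tensorPow_le x)

theorem dualFormAux_apply (φ : StrongDual 𝕜 (α.Completion E)) (x : Fin n → E) :
    dualFormAux φ x = (n.factorial : 𝕜)⁻¹ * ∑ T : Finset (Fin n),
      (-1 : ℤ) ^ T.card • φ (α.pow (∑ i ∈ Tᶜ, x i)) := by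
  let ℓ : SymTensor 𝕜 n E →ₗ[𝕜] 𝕜 :=
    (φ.comp (UniformSpace.Completion.toComplL : α.Space E →L[𝕜] α.Completion E)).toLinearMap
  have h : dualFormAux φ x = ℓ (symProd 𝕜 n E x) := rfl
  rw [h, symProd_apply, map_smul, map_sum, smul_eq_mul]
  congr 1
  refine Finset.sum_congr rfl fun T _ => ?_
  rw [map_zsmul]
  rfl

theorem dualFormAux_bound (φ : StrongDual 𝕜 (α.Completion E)) :
    ∃ C : ℝ, ∀ x : Fin n → E, ‖dualFormAux φ x‖ ≤ C * ∏ i, ‖x i‖ := by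
  refine ⟨‖(n.factorial : 𝕜)⁻¹‖ * ∑ _T : Finset (Fin n), ‖φ‖ * (n : ℝ) ^ n, fun x => ?_⟩
  by_cases hx : ∃ i, x i = 0
  · obtain ⟨i, hi⟩ := hx
    rw [(dualFormAux φ).map_coord_zero i hi, norm_zero]
    positivity
  · push Not at hx
    have key : ∀ y : Fin n → E, (∀ i, ‖y i‖ ≤ 1) →
        ‖dualFormAux φ y‖ ≤ ‖(n.factorial : 𝕜)⁻¹‖ * ∑ _T : Finset (Fin n), ‖φ‖ * (n : ℝ) ^ n := by
      intro y hy
      rw [dualFormAux_apply, norm_mul]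
      gcongr
      refine (norm_sum_le _ _).trans (Finset.sum_le_sum fun T _ => ?_)
      have h1 : ‖(-1 : ℤ) ^ T.card • φ (α.pow (∑ i ∈ Tᶜ, y i))‖ =
          ‖φ (α.pow (∑ i ∈ Tᶜ, y i))‖ := by
        rcases neg_one_pow_eq_or ℤ T.card with h | h <;> simp [h]
      have h2 : ‖∑ i ∈ Tᶜ, y i‖ ≤ n := by
        refine (norm_sum_le _ _).trans ((Finset.sum_le_sum fun i _ => hy i).trans ?_)
        simpa using Finset.card_le_univ (Tᶜ)
      rw [h1]
      refine (φ.le_opNorm _).trans ?_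
      gcongr
      exact (norm_pow_le _).trans (by gcongr)
    have hs : x = fun i => ((‖x i‖ : ℝ) : 𝕜) • (((‖x i‖ : ℝ) : 𝕜)⁻¹ • x i) := by
      funext i
      have : ((‖x i‖ : ℝ) : 𝕜) ≠ 0 := by simpa using hx i
      rw [smul_smul, mul_inv_cancel₀ this, one_smul]
    conv_lhs => rw [hs]
    rw [MultilinearMap.map_smul_univ, norm_smul, norm_prod, mul_comm]
    simp only [RCLike.norm_ofReal, abs_norm]
    gcongr
    refine key _ fun i => ?_
    have : ‖x i‖ ≠ 0 := by simpa using hx i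
    simp [norm_smul, this]

/-- The continuous `n`-homogeneous polynomial `x ↦ φ (x ⊗ ⋯ ⊗ x)` that is identified with the
functional `φ` on the completed symmetric tensor product. -/
def toPoly (φ : StrongDual 𝕜 (α.Completion E)) : HomPoly 𝕜 n E :=
  ⟨fun x => φ (α.pow x), (dualFormAux φ).mkContinuous _ (dualFormAux_bound φ).choose_spec, by
    funext x
    change φ.comp (UniformSpace.Completion.toComplL : α.Space E →L[𝕜] α.Completion E)
      (symProd 𝕜 n E fun _ => x) = _
    rw [symProd_diag]
    rfl⟩

end STensorNorm

/-! ### Polynomial ideals -/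

/-- A Banach ideal of continuous scalar valued `n`-homogeneous polynomials. -/
structure PolyIdeal (𝕜 : Type u) [RCLike 𝕜] (n : ℕ) where
  /-- The component `𝒬(E)`. -/
  space : ∀ (E : Type u) [NormedAddCommGroup E] [NormedSpace 𝕜 E] [CompleteSpace E],
    Submodule 𝕜 (HomPoly 𝕜 n E)
  /-- The ideal norm on `𝒬(E)`. -/
  norm : ∀ (E : Type u) [NormedAddCommGroup E] [NormedSpace 𝕜 E] [CompleteSpace E],
    Seminorm 𝕜 (space E)
  eq_zero_of_norm_eq_zero : ∀ (E : Type u) [NormedAddCommGroup E] [NormedSpace 𝕜 E]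
    [CompleteSpace E] (P : space E), norm E P = 0 → P = 0
  /-- `𝒬(E)` is complete: Cauchy sequences converge. -/
  complete : ∀ (E : Type u) [NormedAddCommGroup E] [NormedSpace 𝕜 E] [CompleteSpace E]
    (p : ℕ → space E),
    (∀ ε > 0, ∃ N, ∀ k ≥ N, ∀ l ≥ N, norm E (p k - p l) < ε) →
      ∃ P : space E, Tendsto (fun k => norm E (p k - P)) atTop (𝓝 0)
  comp_mem : ∀ (E F : Type u) [NormedAddCommGroup E] [NormedSpace 𝕜 E] [CompleteSpace E]
    [NormedAddCommGroup F] [NormedSpace 𝕜 F] [CompleteSpace F] (T : F →L[𝕜] E)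
    (P : HomPoly 𝕜 n E), P ∈ space E → HomPoly.comp P T ∈ space F
  norm_comp_le : ∀ (E F : Type u) [NormedAddCommGroup E] [NormedSpace 𝕜 E] [CompleteSpace E]
    [NormedAddCommGroup F] [NormedSpace 𝕜 F] [CompleteSpace F] (T : F →L[𝕜] E)
    (P : HomPoly 𝕜 n E) (hP : P ∈ space E),
    norm F ⟨HomPoly.comp P T, comp_mem E F T P hP⟩ ≤ norm E ⟨P, hP⟩ * ‖T‖ ^ n
  pow_mem : HomPoly.pow 𝕜 n ∈ space 𝕜
  norm_pow : norm 𝕜 ⟨HomPoly.pow 𝕜 n, pow_mem⟩ = 1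

namespace PolyIdeal

variable {𝕜 : Type u} [RCLike 𝕜] {n : ℕ} (𝒬 : PolyIdeal 𝕜 n)

open Classical in
/-- The ideal norm as a function on `𝒫ⁿ(E)`, with value `∞` outside `𝒬(E)`. -/
def extNorm {E : Type u} [NormedAddCommGroup E] [NormedSpace 𝕜 E] [CompleteSpace E]
    (P : HomPoly 𝕜 n E) : ℝ≥0∞ :=
  if h : P ∈ 𝒬.space E then ENNReal.ofReal (𝒬.norm E ⟨P, h⟩) else ∞

/-- The norm of the maximal kernel: the supremum of the ideal norms of the restrictions of `P` to
the finite dimensional subspaces. -/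
def maxNorm {E : Type u} [NormedAddCommGroup E] [NormedSpace 𝕜 E] [CompleteSpace E]
    (P : HomPoly 𝕜 n E) : ℝ≥0∞ :=
  ⨆ (M : Submodule 𝕜 E) (_ : FiniteDimensional 𝕜 M),
    haveI := FiniteDimensional.complete 𝕜 M; 𝒬.extNorm (HomPoly.comp P M.subtypeL)

/-- `𝒬` is maximal: it coincides isometrically with its maximal kernel, the ideal of all `P` with
`maxNorm P < ∞`, normed by `maxNorm`. -/
def IsMaximal : Prop :=
  ∀ (E : Type u) [NormedAddCommGroup E] [NormedSpace 𝕜 E] [CompleteSpace E]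
    (P : HomPoly 𝕜 n E), 𝒬.extNorm P = 𝒬.maxNorm P

end PolyIdeal

end

/-!
Let `M` be finite dimensional. By weak local reflexivity, an operator `J : M → E''` is a pointwise
weak-star limit of operators `M → E` of norm at most `‖J‖`. The Aron–Berner extension is not
weak-star continuous on the diagonal, so the approximating operators `R₁, R₂, …` are chosen one
after the other: then `A (R_{i₁} z, …, R_{iₙ} z)` is close to `Ã (J z, …, J z)` whenever
`i₁ < ⋯ < iₙ` and, by symmetry of `A`, for all tuples of distinct indices. In the averages
`T = (R₁ + ⋯ + R_N) / N` the tuples with a repeated index are negligible for large `N`, so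
`AB(P) ∘ J` is a pointwise limit of polynomials `P ∘ T` with `‖T‖ ≤ ‖J‖`.

Both norms are determined by finite dimensional subspaces and bounded sets are closed under
pointwise convergence there, so `AB` does not increase the norm. It does not decrease it either,
since `AB(P)` restricts to `P` on `E`.
-/

noncomputable section

set_option maxSynthPendingDepth 3

section Goldstine

variable {𝕜 : Type*} [RCLike 𝕜] {X : Type*} [NormedAddCommGroup X] [NormedSpace 𝕜 X]

theorem mul_norm_le_of_forall_re_le {f : StrongDual 𝕜 X} {r u : ℝ} (hr : 0 ≤ r)
    (hf : ∀ x ∈ Metric.closedBall (0 : X) r, RCLike.re (f x) ≤ u) : r * ‖f‖ ≤ u := by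
  have hu : 0 ≤ u := by simpa using hf 0 (Metric.mem_closedBall_self hr)
  suffices ‖(r : 𝕜) • f‖ ≤ u by rwa [norm_smul, RCLike.norm_of_nonneg hr] at this
  refine ContinuousLinearMap.opNorm_le_of_unit_norm hu fun x hx => ?_
  obtain ⟨d, hd, hdf⟩ := RCLike.exists_norm_eq_mul_self (((r : 𝕜) • f) x)
  have h := hf (d • (r : 𝕜) • x) (by simp [norm_smul, hd, hx, abs_of_nonneg hr])
  rwa [f.map_smul, f.map_smul, smul_eq_mul, ← smul_apply, ← hdf, RCLike.ofReal_re] at h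

theorem bidual_apply_mem_closure_image_closedBall {ι : Type*} [Finite ι] {ξ : Bidual 𝕜 X} {r : ℝ}
    (hξ : ‖ξ‖ ≤ r) (f : ι → StrongDual 𝕜 X) :
    (fun i => ξ (f i)) ∈ closure (ContinuousLinearMap.pi f '' Metric.closedBall 0 r) := by
  classical
  have := Fintype.ofFinite ι
  let _ : NormedSpace ℝ X := NormedSpace.restrictScalars ℝ 𝕜 X
  have : IsScalarTower ℝ 𝕜 X := .of_algebraMap_smul fun _ _ => rfl
  by_contra hmem
  obtain ⟨F, u, hFball, hFξ⟩ := RCLike.geometric_hahn_banach_closed_point (𝕜 := 𝕜)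
    ((convex_closedBall 0 r).linear_image
      ((ContinuousLinearMap.pi f).toLinearMap.restrictScalars ℝ)).closure isClosed_closure hmem
  let c : ι → 𝕜 := fun i => F fun j => if i = j then 1 else 0
  have hF (s : ι → 𝕜) : F s = ∑ i, s i * c i := F.toLinearMap.pi_apply_eq_sum_univ s
  have hball : r * ‖∑ i, c i • f i‖ ≤ u :=
    mul_norm_le_of_forall_re_le ((norm_nonneg ξ).trans hξ) fun x hx => by
      have h := (hFball _ (subset_closure ⟨x, hx, rfl⟩)).le
      simpa [hF, mul_comm] using h
  refine (hFξ.trans_le ?_).not_ge hball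
  calc RCLike.re (F fun i => ξ (f i)) = RCLike.re (ξ (∑ i, c i • f i)) := by
        simp only [hF, map_sum, map_smul, smul_eq_mul, mul_comm]
    _ ≤ ‖ξ (∑ i, c i • f i)‖ := RCLike.re_le_norm _
    _ ≤ r * ‖∑ i, c i • f i‖ := ξ.le_of_opNorm_le hξ _

theorem mem_closure_pi_of_forall_finset {ι : Type*} {Y : ι → Type*} [∀ i, TopologicalSpace (Y i)]
    {s : Set (∀ i, Y i)} {x : ∀ i, Y i}
    (h : ∀ I : Finset ι, I.restrict x ∈ closure (I.restrict '' s)) : x ∈ closure s := by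
  refine mem_closure_iff.mpr fun U hU hx => ?_
  obtain ⟨I, u, hu, hIU⟩ := isOpen_pi_iff.mp hU x hx
  obtain ⟨_, hy, y, hys, rfl⟩ := mem_closure_iff.mp (h I)
    (Set.univ.pi fun i : I => u i) (isOpen_set_pi Set.finite_univ fun i _ => (hu i i.2).1)
    fun i _ => (hu i i.2).2
  exact ⟨y, hIU fun i hi => hy ⟨i, hi⟩ trivial, hys⟩

theorem goldstine {ξ : Bidual 𝕜 X} {r : ℝ} (hξ : ‖ξ‖ ≤ r) :
    ⇑ξ ∈ closure ((fun (x : X) (f : StrongDual 𝕜 X) => f x) '' Metric.closedBall 0 r) :=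
  mem_closure_pi_of_forall_finset fun I => by
    rw [Set.image_image]
    exact bidual_apply_mem_closure_image_closedBall hξ fun f : I => f.1

end Goldstine

section LocalReflexivity

variable {𝕜 : Type*} [RCLike 𝕜] {E M X Y : Type*} [NormedAddCommGroup E] [NormedSpace 𝕜 E]
  [NormedAddCommGroup M] [NormedSpace 𝕜 M] [NormedAddCommGroup X] [NormedSpace 𝕜 X]
  [NormedAddCommGroup Y] [NormedSpace 𝕜 Y]

theorem sum_norm_apply_single_le {ι : Type*} [Fintype ι] [DecidableEq ι]
    (h : StrongDual 𝕜 (ι → E)) {v : ι → E} (hv : ∀ i, ‖v i‖ ≤ 1) :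
    ∑ i, ‖h (Pi.single i (v i))‖ ≤ ‖h‖ := by
  choose d hd hdh using fun i => RCLike.exists_norm_eq_mul_self (h (Pi.single i (v i)))
  have hw : ‖fun i => d i • v i‖ ≤ 1 :=
    (pi_norm_le_iff_of_nonneg zero_le_one).mpr fun i => by rw [norm_smul, hd, one_mul]; exact hv i
  have hsum : h (fun i => d i • v i) = ((∑ i, ‖h (Pi.single i (v i))‖ : ℝ) : 𝕜) := by
    rw [← Finset.univ_sum_single fun i => d i • v i, map_sum, RCLike.ofReal_sum]
    exact Finset.sum_congr rfl fun i _ => by rw [Pi.single_smul, map_smul, hdh, smul_eq_mul]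
  calc ∑ i, ‖h (Pi.single i (v i))‖ = ‖h fun i => d i • v i‖ := by
        rw [hsum, RCLike.norm_of_nonneg (Finset.sum_nonneg fun _ _ => norm_nonneg _)]
    _ ≤ ‖h‖ := h.unit_le_opNorm _ hw

theorem sum_norm_comp_single_le {ι : Type*} [Fintype ι] [DecidableEq ι]
    (h : StrongDual 𝕜 (ι → E)) :
    ∑ i, ‖h.comp (ContinuousLinearMap.single 𝕜 (fun _ : ι => E) i)‖ ≤ ‖h‖ := by
  let hsingle : ι → StrongDual 𝕜 E :=
    fun i => h.comp (ContinuousLinearMap.single 𝕜 (fun _ : ι => E) i)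
  have hδ : ∀ δ > 0, ∑ i, ‖hsingle i‖ ≤ ‖h‖ + Fintype.card ι * δ := by
    intro δ hδ
    choose v hv hδv using fun i =>
      (hsingle i).exists_lt_apply_of_lt_opNorm (sub_lt_self ‖hsingle i‖ hδ)
    calc ∑ i, ‖hsingle i‖ ≤ ∑ i, (‖h (Pi.single i (v i))‖ + δ) :=
          Finset.sum_le_sum fun i _ => sub_le_iff_le_add.mp (hδv i).le
      _ = ∑ i, ‖h (Pi.single i (v i))‖ + Fintype.card ι * δ := by
          rw [Finset.sum_add_distrib, Finset.sum_const, nsmul_eq_mul, Finset.card_univ]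
      _ ≤ ‖h‖ + Fintype.card ι * δ := by
          gcongr
          exact sum_norm_apply_single_le h fun i => (hv i).le
  have hlim : Tendsto (fun δ : ℝ => ‖h‖ + Fintype.card ι * δ) (𝓝[>] 0)
      (𝓝 (‖h‖ + Fintype.card ι * 0)) :=
    Continuous.tendsto (by fun_prop) 0 |>.mono_left nhdsWithin_le_nhds
  rw [mul_zero, add_zero] at hlim
  exact ge_of_tendsto hlim (eventually_of_mem self_mem_nhdsWithin hδ)

theorem one_sub_mul_opNorm_le_of_net (R : M →L[𝕜] E) {s : Set M} {ρ δ : ℝ} (hρ : 0 ≤ ρ)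
    (hδ : 0 ≤ δ) (hs : Metric.closedBall (0 : M) 1 ⊆ ⋃ y ∈ s, Metric.ball y δ)
    (hR : ∀ y ∈ s, ‖R y‖ ≤ ρ) : (1 - δ) * ‖R‖ ≤ ρ := by
  have h : ‖R‖ ≤ ρ + ‖R‖ * δ := by
    refine R.opNorm_le_of_unit_norm (by positivity) fun x hx => ?_
    obtain ⟨y, hy, hxy⟩ := Set.mem_iUnion₂.mp (hs (by simp [hx] : x ∈ Metric.closedBall (0 : M) 1))
    calc ‖R x‖ = ‖R y + R (x - y)‖ := by rw [← map_add, add_sub_cancel]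
      _ ≤ ‖R y‖ + ‖R (x - y)‖ := norm_add_le _ _
      _ ≤ ρ + ‖R‖ * δ :=
        add_le_add (hR y hy) (R.le_opNorm_of_le (mem_ball_iff_norm.mp hxy).le)
  linarith

theorem exists_comp_eq_of_antilipschitz (S : X →L[𝕜] Y) {c : ℝ} (hc : 0 < c)
    (hS : ∀ x, c * ‖x‖ ≤ ‖S x‖) (u : StrongDual 𝕜 X) :
    ∃ h : StrongDual 𝕜 Y, h.comp S = u ∧ c * ‖h‖ ≤ ‖u‖ := by
  have hker : LinearMap.ker S.toLinearMap = ⊥ := LinearMap.ker_eq_bot'.mpr fun x hx => by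
    have := hS x
    rw [show S x = 0 from hx, norm_zero] at this
    exact norm_le_zero_iff.mp (nonpos_of_mul_nonpos_right this hc)
  let e := LinearEquiv.ofInjective S.toLinearMap (LinearMap.ker_eq_bot.mp hker)
  have hbound (y : LinearMap.range S.toLinearMap) : ‖u (e.symm y)‖ ≤ ‖u‖ / c * ‖y‖ := by
    have h := hS (e.symm y)
    rw [show S (e.symm y) = y from congrArg Subtype.val (e.apply_symm_apply y)] at h
    calc ‖u (e.symm y)‖ ≤ ‖u‖ * ‖e.symm y‖ := u.le_opNorm _
      _ ≤ ‖u‖ * (‖y‖ / c) := by gcongr; rwa [le_div_iff₀' hc]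
      _ = ‖u‖ / c * ‖y‖ := by ring
  obtain ⟨h, hext, hnorm⟩ := exists_extension_norm_eq (LinearMap.range S.toLinearMap)
    ((u.toLinearMap ∘ₗ e.symm.toLinearMap).mkContinuous (‖u‖ / c) hbound)
  refine ⟨h, ?_, ?_⟩
  · ext x
    have := hext (e x)
    simpa using! this
  · rw [hnorm, ← le_div_iff₀' hc]
    exact LinearMap.mkContinuous_norm_le _ (by positivity) _

variable [FiniteDimensional 𝕜 M]

/-- The functional on `(M → E)'` induced by an operator `J : M → E''` with finite-dimensional
domain: under `(M → E)'' = (M → E'')` it is `J` itself, see `operatorBidual_eval`. -/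
def operatorBidual (J : M →L[𝕜] Bidual 𝕜 E) : Bidual 𝕜 (M →L[𝕜] E) :=
  ∑ i, (J (Module.finBasis 𝕜 M i)).comp
    ((ContinuousLinearMap.compL 𝕜 E (M →L[𝕜] E) 𝕜).flip (ContinuousLinearMap.smulRightL 𝕜 M E
      (LinearMap.toContinuousLinearMap ((Module.finBasis 𝕜 M).coord i))))

theorem operatorBidual_eval (J : M →L[𝕜] Bidual 𝕜 E) (f : StrongDual 𝕜 E) (z : M) :
    operatorBidual J (f.comp (ContinuousLinearMap.apply 𝕜 E z)) = J z f := by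
  conv_rhs => rw [← (Module.finBasis 𝕜 M).sum_repr z, map_sum, sum_apply]
  rw [operatorBidual, sum_apply]
  refine Finset.sum_congr rfl fun i _ => ?_
  rw [map_smul, smul_apply, ← map_smul, ContinuousLinearMap.comp_apply]
  congr 1
  ext x
  simp

theorem norm_operatorBidual_comp_evalOn_le (J : M →L[𝕜] Bidual 𝕜 E) {t : Set M} [Fintype t]
    (ht : t ⊆ Metric.closedBall 0 1) (h : StrongDual 𝕜 (t → E)) :
    ‖operatorBidual J (h.comp
      (ContinuousLinearMap.pi fun y : t => ContinuousLinearMap.apply 𝕜 E (y : M)))‖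
      ≤ ‖J‖ * ‖h‖ := by
  classical
  let hsingle : t → StrongDual 𝕜 E :=
    fun y => h.comp (ContinuousLinearMap.single 𝕜 (fun _ : t => E) y)
  have hdecomp : h.comp
      (ContinuousLinearMap.pi fun y : t => ContinuousLinearMap.apply 𝕜 E (y : M)) =
      ∑ y : t, (hsingle y).comp (ContinuousLinearMap.apply 𝕜 E (y : M)) := by
    ext R
    rw [sum_apply]
    simp only [ContinuousLinearMap.comp_apply, hsingle]
    rw [← map_sum]
    exact congrArg h (Finset.univ_sum_single _).symm
  calc _ = ‖∑ y : t, J y (hsingle y)‖ := by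
        rw [hdecomp, map_sum]; simp only [operatorBidual_eval]
    _ ≤ ∑ y : t, ‖J‖ * ‖hsingle y‖ := norm_sum_le_of_le _ fun y _ =>
        (J y).le_of_opNorm_le (J.unit_le_opNorm _ (mem_closedBall_zero_iff.mp (ht y.2))) _
    _ ≤ ‖J‖ * ‖h‖ := by
        rw [← Finset.mul_sum]
        gcongr
        exact sum_norm_comp_single_le h

theorem norm_operatorBidual_le (J : M →L[𝕜] Bidual 𝕜 E) : ‖operatorBidual J‖ ≤ ‖J‖ := by
  refine ContinuousLinearMap.opNorm_le_bound _ (norm_nonneg J) fun u => ?_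
  have : ProperSpace M := FiniteDimensional.proper 𝕜 M
  have hnet : ∀ δ ∈ Set.Ioo (0 : ℝ) 1, (1 - δ) * ‖operatorBidual J u‖ ≤ ‖J‖ * ‖u‖ := by
    rintro δ ⟨hδ, hδ1⟩
    obtain ⟨t, ht, htf, hcover⟩ := (isCompact_closedBall (0 : M) 1).finite_cover_balls hδ
    have := htf.fintype
    let S : (M →L[𝕜] E) →L[𝕜] (t → E) :=
      ContinuousLinearMap.pi fun y => ContinuousLinearMap.apply 𝕜 E (y : M)
    have hS (R : M →L[𝕜] E) : (1 - δ) * ‖R‖ ≤ ‖S R‖ :=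
      one_sub_mul_opNorm_le_of_net R (norm_nonneg _) hδ.le hcover fun y hy =>
        norm_le_pi_norm (S R) ⟨y, hy⟩
    obtain ⟨h, rfl, hh⟩ := exists_comp_eq_of_antilipschitz S (sub_pos.mpr hδ1) hS u
    calc (1 - δ) * ‖operatorBidual J (h.comp S)‖ ≤ (1 - δ) * (‖J‖ * ‖h‖) := by
          gcongr
          exact norm_operatorBidual_comp_evalOn_le J ht h
      _ = ‖J‖ * ((1 - δ) * ‖h‖) := by ring
      _ ≤ ‖J‖ * ‖h.comp S‖ := by gcongr
  have hlim : Tendsto (fun δ : ℝ => (1 - δ) * ‖operatorBidual J u‖) (𝓝[>] 0)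
      (𝓝 ((1 - 0) * ‖operatorBidual J u‖)) :=
    Continuous.tendsto (by fun_prop) 0 |>.mono_left nhdsWithin_le_nhds
  rw [sub_zero, one_mul] at hlim
  exact le_of_tendsto hlim (eventually_of_mem (Ioo_mem_nhdsGT one_pos) hnet)

theorem weak_local_reflexivity (J : M →L[𝕜] Bidual 𝕜 E) :
    (fun z f => J z f) ∈ closure ((fun (R : M →L[𝕜] E) z (f : StrongDual 𝕜 E) => f (R z)) ''
      Metric.closedBall 0 ‖J‖) := by
  let restrict (v : StrongDual 𝕜 (M →L[𝕜] E) → 𝕜) (z : M) (f : StrongDual 𝕜 E) : 𝕜 :=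
    v (f.comp (ContinuousLinearMap.apply 𝕜 E z))
  have hrestrict : Continuous restrict := by fun_prop
  have hJ : restrict (operatorBidual J) = fun z f => J z f :=
    funext₂ fun z f => operatorBidual_eval J f z
  have h := image_closure_subset_closure_image hrestrict
    ⟨_, goldstine (norm_operatorBidual_le J), rfl⟩
  rwa [Set.image_image, hJ] at h

end LocalReflexivity

section IteratedLimits

variable {X Y Z : Type*}

theorem neBot_bind {l : Filter X} [l.NeBot] {m : X → Filter Y} (hm : ∀ x, (m x).NeBot) :
    (l.bind m).NeBot := by
  simp only [neBot_iff, Ne, ← eventually_false_iff_eq_bot, eventually_bind] at hm ⊢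
  simpa [hm] using NeBot.ne ‹l.NeBot›

theorem tendsto_bind_nhds [TopologicalSpace Z] {l : Filter X} {m : X → Filter Y} {F : Y → Z}
    {g : X → Z} {c : Z} (hg : Tendsto g l (𝓝 c)) (hF : ∀ x, Tendsto F (m x) (𝓝 (g x))) :
    Tendsto F (l.bind m) (𝓝 c) := by
  refine tendsto_nhds.mpr fun s hs hc => mem_bind'.mpr ?_
  filter_upwards [hg (hs.mem_nhds hc)] with x hx using hF x (hs.mem_nhds hx)

/-- The filter of the tuples whose entries are chosen one after the other along `l`: a limit along
`iteratedFilter l N` is an iterated limit, the innermost one being in the last entry. -/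
def iteratedFilter (l : Filter X) : (N : ℕ) → Filter (Fin N → X)
  | 0 => pure Fin.elim0
  | N + 1 => (iteratedFilter l N).bind fun x => l.map (Fin.snoc (α := fun _ => X) x)

theorem iteratedFilter_neBot (l : Filter X) [l.NeBot] : ∀ N, (iteratedFilter l N).NeBot
  | 0 => pure_neBot
  | N + 1 => have := iteratedFilter_neBot l N; neBot_bind fun _ => inferInstance

theorem exists_strictMono_castSucc_comp_eq {n N : ℕ} {i : Fin n → Fin (N + 1)} (hi : StrictMono i)
    (hlast : ∀ j, i j ≠ Fin.last N) :
    ∃ i' : Fin n → Fin N, StrictMono i' ∧ Fin.castSucc ∘ i' = i := by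
  choose i' hi' using fun j => Fin.exists_castSucc_eq.mpr (hlast j)
  obtain rfl : Fin.castSucc ∘ i' = i := funext hi'
  exact ⟨i', fun a b hab => Fin.castSucc_lt_castSucc_iff.mp (hi hab), rfl⟩

theorem tendsto_comp_iteratedFilter (l : Filter X) :
    ∀ {N n : ℕ} {i : Fin n → Fin N}, StrictMono i →
      Tendsto (fun x : Fin N → X => x ∘ i) (iteratedFilter l N) (iteratedFilter l n)
  | _, 0, _, _ => tendsto_pure.mpr (.of_forall fun _ => Subsingleton.elim _ _)
  | 0, _ + 1, i, _ => (i 0).elim0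
  | N + 1, n + 1, i, hi => by
      intro s hs
      rw [mem_map, iteratedFilter, mem_bind']
      by_cases hlast : i (Fin.last n) = Fin.last N
      · obtain ⟨i', hi', hii'⟩ := exists_strictMono_castSucc_comp_eq
          (hi.comp Fin.strictMono_castSucc) fun j => (hlast ▸ hi j.castSucc_lt_last).ne
        have hcomp (x : Fin N → X) (y : X) :
            (Fin.snoc x y : Fin (N + 1) → X) ∘ i = (Fin.snoc (x ∘ i') y : Fin (n + 1) → X) := by
          refine funext fun j => Fin.lastCases ?_ (fun j => ?_) j
          · simp [hlast]
          · simp [← show (i' j).castSucc = i j.castSucc from congrFun hii' j]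
        filter_upwards [tendsto_comp_iteratedFilter l hi' (mem_bind'.mp hs)] with x hx
        refine mem_map.mpr (mem_of_superset (mem_map.mp hx) fun y hy => ?_)
        rwa [Set.mem_preimage, Set.mem_preimage, hcomp]
      · obtain ⟨i', hi', rfl⟩ := exists_strictMono_castSucc_comp_eq hi fun j =>
          ((hi.monotone j.le_last).trans_lt (Fin.lt_last_iff_ne_last.mpr hlast)).ne
        have hcomp (x : Fin N → X) (y : X) :
            (Fin.snoc x y : Fin (N + 1) → X) ∘ Fin.castSucc ∘ i' = x ∘ i' := by
          ext j
          simp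
        filter_upwards [tendsto_comp_iteratedFilter l hi' hs] with x hx
        refine mem_map.mpr (univ_mem' fun y => ?_)
        rwa [Set.mem_preimage, Set.mem_preimage, hcomp]

variable {𝕜 : Type*} [RCLike 𝕜] {E : Type*} [NormedAddCommGroup E] [NormedSpace 𝕜 E]
  {l : Filter X} {g : X → E} {ξ : Bidual 𝕜 E}

theorem tendsto_iteratedFilter_aronBernerVal
    (hg : ∀ f : StrongDual 𝕜 E, Tendsto (fun x => f (g x)) l (𝓝 (ξ f))) :
    ∀ {n : ℕ} (A : E [×n]→L[𝕜] 𝕜), Tendsto (fun x : Fin n → X => A (g ∘ x)) (iteratedFilter l n)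
      (𝓝 (aronBernerVal n A fun _ => ξ))
  | 0, A => tendsto_pure_left.mpr fun s hs => by
      rw [Subsingleton.elim (g ∘ Fin.elim0) 0]
      exact mem_of_mem_nhds hs
  | n + 1, A => by
      refine tendsto_bind_nhds
        (tendsto_iteratedFilter_aronBernerVal hg (ξ.compContinuousMultilinearMap A.curryRight))
        fun x => tendsto_map'_iff.mpr ((hg (A.curryRight (g ∘ x))).congr fun y => ?_)
      rw [Function.comp_apply, Fin.comp_snoc, ContinuousMultilinearMap.curryRight_apply]

theorem tendsto_iteratedFilter_aronBernerVal_of_injective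
    (hg : ∀ f : StrongDual 𝕜 E, Tendsto (fun x => f (g x)) l (𝓝 (ξ f))) {n N : ℕ}
    {A : E [×n]→L[𝕜] 𝕜} (hA : ∀ (τ : Equiv.Perm (Fin n)) v, A (v ∘ τ) = A v)
    {i : Fin n → Fin N} (hi : Function.Injective i) :
    Tendsto (fun x : Fin N → X => A (g ∘ x ∘ i)) (iteratedFilter l N)
      (𝓝 (aronBernerVal n A fun _ => ξ)) := by
  have hsort : StrictMono (i ∘ Tuple.sort i) :=
    (Tuple.monotone_sort i).strictMono_of_injective (hi.comp (Tuple.sort i).injective)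
  refine ((tendsto_iteratedFilter_aronBernerVal hg A).comp
    (tendsto_comp_iteratedFilter l hsort)).congr fun x => ?_
  exact hA (Tuple.sort i) (g ∘ x ∘ i)

end IteratedLimits

section Averages

variable {𝕜 : Type*} [RCLike 𝕜] {E F : Type*} [NormedAddCommGroup E] [NormedSpace 𝕜 E]
  [NormedAddCommGroup F] [NormedSpace 𝕜 F] {n N : ℕ}

theorem norm_average_le {x : Fin N → E} {r : ℝ} (hr : 0 ≤ r) (hx : ∀ i, ‖x i‖ ≤ r) :
    ‖(N : 𝕜)⁻¹ • ∑ i, x i‖ ≤ r := by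
  have hsum : ‖∑ i, x i‖ ≤ N * r := by
    simpa using norm_sum_le_of_le Finset.univ fun i _ => hx i
  calc ‖(N : 𝕜)⁻¹ • ∑ i, x i‖ = (N : ℝ)⁻¹ * ‖∑ i, x i‖ := by
        rw [norm_smul, norm_inv, RCLike.norm_natCast]
    _ ≤ (N : ℝ)⁻¹ * (N * r) := by gcongr
    _ ≤ r := by rw [← mul_assoc]; exact mul_le_of_le_one_left hr inv_mul_le_one

theorem apply_average_sub (A : E [×n]→L[𝕜] F) (hN : N ≠ 0) (x : Fin N → E) (c : F) :
    (A fun _ => (N : 𝕜)⁻¹ • ∑ i, x i) - c =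
      ((N : 𝕜) ^ n)⁻¹ • ∑ i : Fin n → Fin N, (A (x ∘ i) - c) := by
  have hNn : (N : 𝕜) ^ n ≠ 0 := pow_ne_zero _ (Nat.cast_ne_zero.mpr hN)
  rw [A.map_smul_univ (fun _ => (N : 𝕜)⁻¹) fun _ => ∑ i, x i, A.map_sum]
  simp [Function.comp_def, Finset.sum_sub_distrib, smul_sub, ← Nat.cast_smul_eq_nsmul 𝕜, hNn]

theorem card_filter_not_injective
    [DecidablePred (Function.Injective : (Fin n → Fin N) → Prop)] :
    (Finset.univ.filter fun i : Fin n → Fin N => ¬ Function.Injective i).card =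
      (N : ℝ) ^ n - N.descFactorial n := by
  have hinj : (Finset.univ.filter fun i : Fin n → Fin N => Function.Injective i).card =
      N.descFactorial n := by
    rw [← Fintype.card_subtype, Fintype.card_congr (Equiv.subtypeInjectiveEquivEmbedding _ _),
      Fintype.card_embedding_eq, Fintype.card_fin, Fintype.card_fin]
  have h := Finset.card_filter_add_card_filter_not (s := Finset.univ)
    fun i : Fin n → Fin N => Function.Injective i
  rw [hinj, Finset.card_univ, Fintype.card_fun, Fintype.card_fin, Fintype.card_fin] at h
  rw [eq_sub_iff_add_eq', ← Nat.cast_add, h, Nat.cast_pow]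

theorem norm_apply_average_sub_le (A : E [×n]→L[𝕜] F) (hN : N ≠ 0) {x : Fin N → E} {c : F}
    {r δ : ℝ} (hδ : 0 ≤ δ) (hx : ∀ i, ‖x i‖ ≤ r)
    (hinj : ∀ i : Fin n → Fin N, Function.Injective i → ‖A (x ∘ i) - c‖ ≤ δ) :
    ‖(A fun _ => (N : 𝕜)⁻¹ • ∑ i, x i) - c‖ ≤
      δ + (1 - N.descFactorial n / (N : ℝ) ^ n) * (‖A‖ * r ^ n + ‖c‖) := by
  classical
  set C := ‖A‖ * r ^ n + ‖c‖
  have hC (i : Fin n → Fin N) : ‖A (x ∘ i) - c‖ ≤ C := by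
    refine (norm_sub_le _ _).trans (add_le_add_left ((A.le_opNorm _).trans ?_) _)
    gcongr
    simpa using Finset.prod_le_prod (s := Finset.univ) (fun _ _ => norm_nonneg _)
      fun j _ => hx (i j)
  have hterm (i : Fin n → Fin N) :
      ‖A (x ∘ i) - c‖ ≤ δ + if ¬ Function.Injective i then C else 0 := by
    split_ifs with hi
    · simpa using hinj i hi
    · exact (hC i).trans (le_add_of_nonneg_left hδ)
  have hsum : ∑ i : Fin n → Fin N, ‖A (x ∘ i) - c‖ ≤
      N ^ n * δ + (N ^ n - N.descFactorial n) * C := by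
    refine (Finset.sum_le_sum fun i _ => hterm i).trans_eq ?_
    rw [Finset.sum_add_distrib, ← Finset.sum_filter, Finset.sum_const, Finset.sum_const,
      nsmul_eq_mul, nsmul_eq_mul, card_filter_not_injective]
    simp
  calc _ = ((N : ℝ) ^ n)⁻¹ * ‖∑ i : Fin n → Fin N, (A (x ∘ i) - c)‖ := by
        rw [apply_average_sub A hN, norm_smul, norm_inv, norm_pow, RCLike.norm_natCast]
    _ ≤ ((N : ℝ) ^ n)⁻¹ * (N ^ n * δ + (N ^ n - N.descFactorial n) * C) := by
        gcongr
        exact (norm_sum_le _ _).trans hsum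
    _ = δ + (1 - N.descFactorial n / (N : ℝ) ^ n) * C := by field_simp

theorem tendsto_descFactorial_div_pow (n : ℕ) :
    Tendsto (fun N : ℕ => N.descFactorial n / (N : ℝ) ^ n) atTop (𝓝 1) :=
  (Asymptotics.isEquivalent_iff_tendsto_one <| by
    filter_upwards [eventually_gt_atTop 0] with N hN; positivity).mp (isEquivalent_descFactorial n)

end Averages

section AverageFilter

variable {𝕜 : Type*} [RCLike 𝕜] {X E V W : Type*} [NormedAddCommGroup E] [NormedSpace 𝕜 E]
  [NormedAddCommGroup V] [NormedSpace 𝕜 V] [NormedAddCommGroup W] [NormedSpace 𝕜 W]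

variable (𝕜) in
/-- The filter of the averages `(g x₁ + ⋯ + g x_N) / N` as `N → ∞`, where for each `N` the points
`x₁, …, x_N` are chosen one after the other along `l`. -/
def averageFilter (l : Filter X) (g : X → V) : Filter V :=
  atTop.bind fun N : ℕ => (iteratedFilter l N).map fun x => (N : 𝕜)⁻¹ • ∑ i, g (x i)

theorem averageFilter_neBot (l : Filter X) [l.NeBot] (g : X → V) :
    (averageFilter 𝕜 l g).NeBot :=
  neBot_bind fun _ => (iteratedFilter_neBot l _).map _

theorem closedBall_mem_averageFilter (l : Filter X) {g : X → V} {r : ℝ} (hr : 0 ≤ r)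
    (hg : ∀ x, ‖g x‖ ≤ r) : Metric.closedBall 0 r ∈ averageFilter 𝕜 l g :=
  mem_bind'.mpr <| univ_mem' fun _ => mem_map.mpr <| univ_mem' fun x =>
    mem_closedBall_zero_iff.mpr <| norm_average_le hr fun i => hg (x i)

theorem map_averageFilter (u : V →L[𝕜] W) (l : Filter X) (g : X → V) :
    (averageFilter 𝕜 l g).map u = averageFilter 𝕜 l (u ∘ g) := by
  simp only [averageFilter, map_bind, map_map, Function.comp_def, map_smul, map_sum]

theorem tendsto_averageFilter_aronBernerVal {l : Filter X} {g : X → E} {ξ : Bidual 𝕜 E} {r : ℝ}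
    (hgr : ∀ x, ‖g x‖ ≤ r)
    (hg : ∀ f : StrongDual 𝕜 E, Tendsto (fun x => f (g x)) l (𝓝 (ξ f))) {n : ℕ}
    {A : E [×n]→L[𝕜] 𝕜} (hA : ∀ (τ : Equiv.Perm (Fin n)) v, A (v ∘ τ) = A v) :
    Tendsto (fun v => A fun _ => v) (averageFilter 𝕜 l g) (𝓝 (aronBernerVal n A fun _ => ξ)) := by
  set c := aronBernerVal n A fun _ => ξ
  refine Metric.tendsto_nhds.mpr fun ε hε => eventually_bind.mpr ?_
  have hlim : Tendsto (fun N : ℕ =>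
      ε / 2 + (1 - N.descFactorial n / (N : ℝ) ^ n) * (‖A‖ * r ^ n + ‖c‖)) atTop (𝓝 (ε / 2)) := by
    simpa using (((tendsto_descFactorial_div_pow n).const_sub 1).mul_const _).const_add (ε / 2)
  filter_upwards [hlim.eventually_lt_const (half_lt_self hε), eventually_ne_atTop 0] with N hNε hN
  have hinj : ∀ᶠ x in iteratedFilter l N, ∀ i : Fin n → Fin N, Function.Injective i →
      ‖A (g ∘ x ∘ i) - c‖ ≤ ε / 2 := by
    refine eventually_all.mpr fun i => eventually_imp_distrib_left.mpr fun hi => ?_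
    filter_upwards [Metric.tendsto_nhds.mp
      (tendsto_iteratedFilter_aronBernerVal_of_injective hg hA hi) _ (half_pos hε)] with x hx
    exact (dist_eq_norm (A (g ∘ x ∘ i)) c ▸ hx).le
  refine eventually_map.mpr (hinj.mono fun x hx => ?_)
  rw [dist_eq_norm]
  exact (norm_apply_average_sub_le A hN (half_pos hε).le (fun i => hgr (x i)) hx).trans_lt hNε

variable [FiniteDimensional 𝕜 V] {n : ℕ}

theorem comp_aronBerner_mem_closure (P : HomPoly 𝕜 n E) (J : V →L[𝕜] Bidual 𝕜 E) :
    HomPoly.comp (aronBerner P) J ∈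
      closure (HomPoly.comp P '' Metric.closedBall (0 : V →L[𝕜] E) ‖J‖) := by
  let l : Filter (Metric.closedBall (0 : V →L[𝕜] E) ‖J‖) :=
    comap (fun T z (f : StrongDual 𝕜 E) => f (T.1 z)) (𝓝 fun z f => J z f)
  have : l.NeBot := comap_neBot fun s hs => by
    obtain ⟨_, hTs, T, hT, rfl⟩ := mem_closure_iff_nhds.mp (weak_local_reflexivity J) s hs
    exact ⟨⟨T, hT⟩, hTs⟩
  have hl (z : V) (f : StrongDual 𝕜 E) : Tendsto (fun T => f (T.1 z)) l (𝓝 (J z f)) :=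
    (((continuous_apply f).comp (continuous_apply z)).tendsto fun z f => J z f).comp tendsto_comap
  have hnorm (T : Metric.closedBall (0 : V →L[𝕜] E) ‖J‖) : ‖T.1‖ ≤ ‖J‖ :=
    mem_closedBall_zero_iff.mp T.2
  have := averageFilter_neBot (𝕜 := 𝕜) l Subtype.val
  have hlim : Tendsto (HomPoly.comp P) (averageFilter 𝕜 l Subtype.val)
      (𝓝 (HomPoly.comp (aronBerner P) J)) := by
    refine tendsto_subtype_rng.mpr (tendsto_pi_nhds.mpr fun z => ?_)
    have h : Tendsto (fun v => HomPoly.symForm P fun _ => v)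
        ((averageFilter 𝕜 l Subtype.val).map (ContinuousLinearMap.apply 𝕜 E z))
        (𝓝 ((aronBerner P).1 (J z))) := by
      rw [map_averageFilter]
      exact tendsto_averageFilter_aronBernerVal (fun T => T.1.le_of_opNorm_le (hnorm T) z) (hl z)
        (HomPoly.symForm_perm P)
    exact (tendsto_map'_iff.mp h).congr fun T => HomPoly.symForm_diag P (T z)
  exact mem_closure_of_tendsto hlim <| mem_of_superset
    (closedBall_mem_averageFilter l (norm_nonneg J) hnorm) (Set.subset_preimage_image _ _)

end AverageFilter

section Inclusion

variable {𝕜 : Type*} [RCLike 𝕜] {E : Type*} [NormedAddCommGroup E] [NormedSpace 𝕜 E]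

theorem aronBernerVal_inclusion : ∀ (n : ℕ) (A : E [×n]→L[𝕜] 𝕜) (x : Fin n → E),
    aronBernerVal n A (fun i => NormedSpace.inclusionInDoubleDual 𝕜 E (x i)) = A x
  | 0, A, x => congrArg A (Subsingleton.elim _ _)
  | n + 1, A, x =>
    calc _ = A.curryRight (Fin.init x) (x (Fin.last n)) := aronBernerVal_inclusion n _ (Fin.init x)
      _ = A x := by rw [ContinuousMultilinearMap.curryRight_apply, Fin.snoc_init_self]

theorem comp_aronBerner_inclusion {n : ℕ} (P : HomPoly 𝕜 n E) :
    HomPoly.comp (aronBerner P) (NormedSpace.inclusionInDoubleDual 𝕜 E) = P :=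
  Subtype.ext <| funext fun x =>
    (aronBernerVal_inclusion n (HomPoly.symForm P) fun _ => x).trans (HomPoly.symForm_diag P x)

end Inclusion

section Linearization

variable {𝕜 : Type*} [RCLike 𝕜] {n : ℕ} {E F : Type*} [NormedAddCommGroup E] [NormedSpace 𝕜 E]
  [NormedAddCommGroup F] [NormedSpace 𝕜 F]

theorem SymTensor.span_range_tensorPow :
    Submodule.span 𝕜 (Set.range (tensorPow 𝕜 n : E → SymTensor 𝕜 n E)) = ⊤ := by
  refine (congrArg (Submodule.span 𝕜) ?_).trans Submodule.span_span_coe_preimage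
  ext z
  exact exists_congr fun x => Subtype.ext_iff

theorem SymTensor.hom_ext {W : Type*} [AddCommMonoid W] [Module 𝕜 W]
    {ℓ₁ ℓ₂ : SymTensor 𝕜 n E →ₗ[𝕜] W} (h : ∀ x, ℓ₁ (tensorPow 𝕜 n x) = ℓ₂ (tensorPow 𝕜 n x)) :
    ℓ₁ = ℓ₂ :=
  LinearMap.ext_on_range SymTensor.span_range_tensorPow h

theorem symTensorMap_tensorPow (T : E →L[𝕜] F) (x : E) :
    symTensorMap n T (tensorPow 𝕜 n x) = tensorPow 𝕜 n (T x) :=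
  Subtype.ext (PiTensorProduct.map_tprod _ _)

namespace HomPoly

/-- The linearization of `P`: the linear functional on the symmetric tensor product with
`x ⊗ ⋯ ⊗ x ↦ P x`. -/
def linearize (P : HomPoly 𝕜 n E) : SymTensor 𝕜 n E →ₗ[𝕜] 𝕜 :=
  (PiTensorProduct.lift (symForm P).toMultilinearMap).comp (SymTensor 𝕜 n E).subtype

theorem linearize_tensorPow (P : HomPoly 𝕜 n E) (x : E) :
    linearize P (tensorPow 𝕜 n x) = P.1 x :=
  (PiTensorProduct.lift.tprod _).trans (symForm_diag P x)

theorem linearize_comp (P : HomPoly 𝕜 n E) (T : F →L[𝕜] E) :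
    linearize (comp P T) = linearize P ∘ₗ symTensorMap n T :=
  SymTensor.hom_ext fun x => by
    rw [LinearMap.comp_apply, symTensorMap_tensorPow, linearize_tensorPow, linearize_tensorPow]
    rfl

theorem continuous_linearize_apply (z : SymTensor 𝕜 n E) :
    Continuous fun P : HomPoly 𝕜 n E => linearize P z := by
  obtain ⟨c, rfl⟩ := Finsupp.mem_span_range_iff_exists_finsupp.mp
    (SymTensor.span_range_tensorPow.ge (Submodule.mem_top (x := z)))
  simp only [Finsupp.sum, map_sum, map_smul, linearize_tensorPow]
  exact continuous_finsetSum _ fun x _ =>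
    ((continuous_apply x).comp continuous_subtype_val).const_smul (c x)

theorem finiteDimensional [FiniteDimensional 𝕜 E] : FiniteDimensional 𝕜 (HomPoly 𝕜 n E) := by
  have : FiniteDimensional 𝕜 (E [×n]→L[𝕜] 𝕜) := FiniteDimensional.of_injective
    (ContinuousMultilinearMap.toMultilinearMapLinear :
      (E [×n]→L[𝕜] 𝕜) →ₗ[𝕜] MultilinearMap 𝕜 (fun _ : Fin n => E) 𝕜)
    ContinuousMultilinearMap.toMultilinearMap_injective
  unfold HomPoly
  infer_instance

end HomPoly

end Linearization

namespace STensorNorm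

variable {𝕜 : Type u} [RCLike 𝕜] {n : ℕ} {α : STensorNorm 𝕜 n} {E F : Type u}
  [NormedAddCommGroup E] [NormedSpace 𝕜 E] [CompleteSpace E]
  [NormedAddCommGroup F] [NormedSpace 𝕜 F] [CompleteSpace F]

variable (α E) in
/-- The canonical map of the symmetric tensor product into its completion for `α`. -/
def toCompletion : SymTensor 𝕜 n E →ₗ[𝕜] α.Completion E :=
  (UniformSpace.Completion.toComplL : α.Space E →L[𝕜] α.Completion E).toLinearMap

theorem norm_toCompletion (z : SymTensor 𝕜 n E) : ‖α.toCompletion E z‖ = α.norm E z :=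
  UniformSpace.Completion.norm_coe (E := α.Space E) z

theorem denseRange_toCompletion : DenseRange (α.toCompletion E) :=
  UniformSpace.Completion.denseRange_coe (α := α.Space E)

theorem apply_toCompletion (φ : StrongDual 𝕜 (α.Completion E)) (z : SymTensor 𝕜 n E) :
    φ (α.toCompletion E z) = HomPoly.linearize (toPoly φ) z :=
  LinearMap.congr_fun
    (SymTensor.hom_ext (ℓ₁ := φ.toLinearMap ∘ₗ α.toCompletion E) fun x =>
      (HomPoly.linearize_tensorPow (toPoly φ) x).symm) z

theorem norm_linearize_toPoly_le (φ : StrongDual 𝕜 (α.Completion E)) (z : SymTensor 𝕜 n E) :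
    ‖HomPoly.linearize (toPoly φ) z‖ ≤ ‖φ‖ * α.norm E z := by
  rw [← apply_toCompletion, ← norm_toCompletion]
  exact φ.le_opNorm _

theorem norm_le_of_norm_linearize_le {φ : StrongDual 𝕜 (α.Completion E)} {C : ℝ} (hC : 0 ≤ C)
    (h : ∀ z, ‖HomPoly.linearize (toPoly φ) z‖ ≤ C * α.norm E z) : ‖φ‖ ≤ C := by
  refine φ.opNorm_le_bound hC fun y => denseRange_toCompletion.induction_on y
    (isClosed_le (by fun_prop) (by fun_prop)) fun z => ?_
  rw [apply_toCompletion, norm_toCompletion]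
  exact h z

theorem exists_toPoly_eq {P : HomPoly 𝕜 n E} {C : ℝ}
    (hP : ∀ z, ‖HomPoly.linearize P z‖ ≤ C * α.norm E z) :
    ∃ φ : StrongDual 𝕜 (α.Completion E), toPoly φ = P := by
  let e := α.toCompletion E
  have hbound z : ‖HomPoly.linearize P z‖ ≤ C * ‖e z‖ := by
    rw [norm_toCompletion]
    exact hP z
  exact ⟨(HomPoly.linearize P).extendOfNorm e, Subtype.ext <| funext fun x =>
    (LinearMap.extendOfNorm_eq denseRange_toCompletion ⟨C, hbound⟩ (tensorPow 𝕜 n x)).trans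
      (HomPoly.linearize_tensorPow P x)⟩

theorem norm_le_of_toPoly_eq_comp {φ : StrongDual 𝕜 (α.Completion F)}
    {ψ : StrongDual 𝕜 (α.Completion E)} {T : F →L[𝕜] E}
    (h : toPoly φ = HomPoly.comp (toPoly ψ) T) : ‖φ‖ ≤ ‖ψ‖ * ‖T‖ ^ n := by
  refine norm_le_of_norm_linearize_le (by positivity) fun z => ?_
  calc ‖HomPoly.linearize (toPoly φ) z‖
      = ‖HomPoly.linearize (toPoly ψ) (symTensorMap n T z)‖ := by
        rw [h, HomPoly.linearize_comp, LinearMap.comp_apply]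
    _ ≤ ‖ψ‖ * α.norm E (symTensorMap n T z) := norm_linearize_toPoly_le ψ _
    _ ≤ ‖ψ‖ * (‖T‖ ^ n * α.norm F z) := by gcongr; exact α.norm_map_le F E T z
    _ = ‖ψ‖ * ‖T‖ ^ n * α.norm F z := (mul_assoc _ _ _).symm

theorem norm_linearize_comp_aronBerner_le [FiniteDimensional 𝕜 F]
    (φ : StrongDual 𝕜 (α.Completion E)) (J : F →L[𝕜] Bidual 𝕜 E) (w : SymTensor 𝕜 n F) :
    ‖HomPoly.linearize (HomPoly.comp (aronBerner (toPoly φ)) J) w‖ ≤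
      ‖φ‖ * (‖J‖ ^ n * α.norm F w) := by
  refine closure_minimal
    (t := {Q : HomPoly 𝕜 n F | ‖HomPoly.linearize Q w‖ ≤ ‖φ‖ * (‖J‖ ^ n * α.norm F w)}) ?_
    (isClosed_le (HomPoly.continuous_linearize_apply w).norm continuous_const)
    (comp_aronBerner_mem_closure (toPoly φ) J)
  rintro _ ⟨T, hT, rfl⟩
  rw [mem_closedBall_zero_iff] at hT
  calc ‖HomPoly.linearize (HomPoly.comp (toPoly φ) T) w‖
      = ‖HomPoly.linearize (toPoly φ) (symTensorMap n T w)‖ := by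
        rw [HomPoly.linearize_comp, LinearMap.comp_apply]
    _ ≤ ‖φ‖ * α.norm E (symTensorMap n T w) := norm_linearize_toPoly_le φ _
    _ ≤ ‖φ‖ * (‖J‖ ^ n * α.norm F w) := by
        gcongr
        exact (α.norm_map_le F E T w).trans (by gcongr)

theorem FinitelyGenerated.norm_linearize_le (hα : α.FinitelyGenerated) {P : HomPoly 𝕜 n E} {C : ℝ}
    (hP : ∀ (M : Submodule 𝕜 E) [FiniteDimensional 𝕜 M] [CompleteSpace M] (w : SymTensor 𝕜 n M),
      ‖HomPoly.linearize (HomPoly.comp P M.subtypeL) w‖ ≤ C * α.norm M w)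
    (z : SymTensor 𝕜 n E) : ‖HomPoly.linearize P z‖ ≤ C * α.norm E z := by
  refine closure_minimal (t := {r : ℝ | ‖HomPoly.linearize P z‖ ≤ C * r}) ?_
    (isClosed_le continuous_const (by fun_prop)) ((hα E z).mem_closure (hα E z).nonempty)
  rintro _ ⟨M, hM, w, rfl, rfl⟩
  have := FiniteDimensional.complete 𝕜 M
  have hw := hP M w
  rwa [HomPoly.linearize_comp, LinearMap.comp_apply] at hw

theorem exists_toPoly_eq_aronBerner (hα : α.FinitelyGenerated)
    (φ : StrongDual 𝕜 (α.Completion E)) :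
    ∃ ψ : StrongDual 𝕜 (α.Completion (Bidual 𝕜 E)),
      toPoly ψ = aronBerner (toPoly φ) ∧ ‖φ‖ = ‖ψ‖ := by
  have hbound z : ‖HomPoly.linearize (aronBerner (toPoly φ)) z‖ ≤
      ‖φ‖ * α.norm (Bidual 𝕜 E) z :=
    hα.norm_linearize_le (fun M _ _ w => by
      refine (norm_linearize_comp_aronBerner_le φ M.subtypeL w).trans ?_
      gcongr
      exact mul_le_of_le_one_left (apply_nonneg _ w)
        (pow_le_one₀ (norm_nonneg _) M.norm_subtypeL_le)) z
  obtain ⟨ψ, hψ⟩ := exists_toPoly_eq hbound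
  refine ⟨ψ, hψ, le_antisymm ?_ (norm_le_of_norm_linearize_le (norm_nonneg φ) (by rwa [hψ]))⟩
  calc ‖φ‖ ≤ ‖ψ‖ * ‖NormedSpace.inclusionInDoubleDual 𝕜 E‖ ^ n :=
        norm_le_of_toPoly_eq_comp (by rw [hψ, comp_aronBerner_inclusion])
    _ ≤ ‖ψ‖ := mul_le_of_le_one_right (norm_nonneg ψ)
        (pow_le_one₀ (norm_nonneg _) (NormedSpace.inclusionInDoubleDual_norm_le 𝕜 E))

end STensorNorm

section Compactness

variable {𝕜 V W : Type*} [RCLike 𝕜] [AddCommGroup V] [Module 𝕜 V] [FiniteDimensional 𝕜 V]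
  [AddCommGroup W] [Module 𝕜 W] [TopologicalSpace W] [IsTopologicalAddGroup W]
  [ContinuousSMul 𝕜 W]

theorem isCompact_image_setOf_seminorm_le {N : Seminorm 𝕜 V} (hN : ∀ v, N v = 0 → v = 0)
    (ℓ : V →ₗ[𝕜] W) (C : ℝ) : IsCompact (ℓ '' {v | N v ≤ C}) := by
  let _ : NormedAddCommGroup V := AddGroupNorm.toNormedAddCommGroup
    { toFun := N
      map_zero' := map_zero N
      add_le' := map_add_le_add N
      neg' := map_neg_eq_map N
      eq_zero_of_map_eq_zero' := hN }
  let _ : NormedSpace 𝕜 V := { norm_smul_le c v := (map_smul_eq_mul N c v).le }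
  have : ProperSpace V := FiniteDimensional.proper 𝕜 V
  have hball : {v | N v ≤ C} = Metric.closedBall (0 : V) C :=
    Set.ext fun _ => (mem_closedBall_zero_iff (E := V)).symm
  rw [hball]
  exact (isCompact_closedBall 0 C).image ℓ.continuous_of_finiteDimensional

end Compactness

namespace PolyIdeal

variable {𝕜 : Type u} [RCLike 𝕜] {n : ℕ} {𝒬 : PolyIdeal 𝕜 n} {E F : Type u}
  [NormedAddCommGroup E] [NormedSpace 𝕜 E] [CompleteSpace E]
  [NormedAddCommGroup F] [NormedSpace 𝕜 F] [CompleteSpace F]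

theorem extNorm_le_ofReal_iff {P : HomPoly 𝕜 n E} {C : ℝ} (hC : 0 ≤ C) :
    𝒬.extNorm P ≤ ENNReal.ofReal C ↔ ∃ hP : P ∈ 𝒬.space E, 𝒬.norm E ⟨P, hP⟩ ≤ C := by
  by_cases hP : P ∈ 𝒬.space E <;> simp [extNorm, hP, ENNReal.ofReal_le_ofReal_iff hC]

theorem isClosed_setOf_extNorm_le [FiniteDimensional 𝕜 E] {C : ℝ} (hC : 0 ≤ C) :
    IsClosed {P : HomPoly 𝕜 n E | 𝒬.extNorm P ≤ ENNReal.ofReal C} := by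
  have : FiniteDimensional 𝕜 (HomPoly 𝕜 n E) := HomPoly.finiteDimensional
  convert (isCompact_image_setOf_seminorm_le (𝒬.eq_zero_of_norm_eq_zero E)
    (𝒬.space E).subtype C).isClosed using 1
  ext P
  simp [extNorm_le_ofReal_iff hC]

theorem extNorm_comp_aronBerner_le [FiniteDimensional 𝕜 F] {P : HomPoly 𝕜 n E}
    (hP : P ∈ 𝒬.space E) (J : F →L[𝕜] Bidual 𝕜 E) :
    𝒬.extNorm (HomPoly.comp (aronBerner P) J) ≤
      ENNReal.ofReal (𝒬.norm E ⟨P, hP⟩ * ‖J‖ ^ n) := by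
  have hC : 0 ≤ 𝒬.norm E ⟨P, hP⟩ * ‖J‖ ^ n := by positivity
  refine closure_minimal ?_ (isClosed_setOf_extNorm_le hC) (comp_aronBerner_mem_closure P J)
  rintro _ ⟨T, hT, rfl⟩
  rw [mem_closedBall_zero_iff] at hT
  exact (extNorm_le_ofReal_iff hC).mpr
    ⟨𝒬.comp_mem E F T P hP, (𝒬.norm_comp_le E F T P hP).trans (by gcongr)⟩

theorem IsMaximal.extNorm_aronBerner_le (h𝒬 : 𝒬.IsMaximal) {P : HomPoly 𝕜 n E}
    (hP : P ∈ 𝒬.space E) :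
    𝒬.extNorm (aronBerner P) ≤ ENNReal.ofReal (𝒬.norm E ⟨P, hP⟩) := by
  rw [h𝒬]
  refine iSup₂_le fun M _ => ?_
  have := FiniteDimensional.complete 𝕜 M
  refine (extNorm_comp_aronBerner_le hP M.subtypeL).trans (ENNReal.ofReal_le_ofReal ?_)
  exact mul_le_of_le_one_right (apply_nonneg _ _)
    (pow_le_one₀ (norm_nonneg _) M.norm_subtypeL_le)

theorem IsMaximal.exists_aronBerner_mem (h𝒬 : 𝒬.IsMaximal) {P : HomPoly 𝕜 n E}
    (hP : P ∈ 𝒬.space E) :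
    ∃ hAB : aronBerner P ∈ 𝒬.space (Bidual 𝕜 E),
      𝒬.norm E ⟨P, hP⟩ = 𝒬.norm (Bidual 𝕜 E) ⟨aronBerner P, hAB⟩ := by
  obtain ⟨hAB, hAB_le⟩ :=
    (extNorm_le_ofReal_iff (apply_nonneg _ _)).mp (h𝒬.extNorm_aronBerner_le hP)
  refine ⟨hAB, le_antisymm ?_ hAB_le⟩
  let ι := NormedSpace.inclusionInDoubleDual 𝕜 E
  have hι : (⟨P, hP⟩ : 𝒬.space E) =
      ⟨HomPoly.comp (aronBerner P) ι, 𝒬.comp_mem (Bidual 𝕜 E) E ι (aronBerner P) hAB⟩ :=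
    Subtype.ext (comp_aronBerner_inclusion P).symm
  calc 𝒬.norm E ⟨P, hP⟩ ≤ 𝒬.norm (Bidual 𝕜 E) ⟨aronBerner P, hAB⟩ * ‖ι‖ ^ n :=
        hι ▸ 𝒬.norm_comp_le (Bidual 𝕜 E) E ι (aronBerner P) hAB
    _ ≤ 𝒬.norm (Bidual 𝕜 E) ⟨aronBerner P, hAB⟩ :=
        mul_le_of_le_one_right (apply_nonneg _ _)
          (pow_le_one₀ (norm_nonneg _) (NormedSpace.inclusionInDoubleDual_norm_le 𝕜 E))

end PolyIdeal

end

theorem corollary3p4 {𝕜 : Type u} [RCLike 𝕜] (n : ℕ)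
    (E : Type u) [NormedAddCommGroup E] [NormedSpace 𝕜 E] [CompleteSpace E] :
    (∀ α : STensorNorm 𝕜 n, α.FinitelyGenerated →
      ∀ φ : StrongDual 𝕜 (α.Completion E),
        ∃ ψ : StrongDual 𝕜 (α.Completion (Bidual 𝕜 E)),
          STensorNorm.toPoly ψ = aronBerner (STensorNorm.toPoly φ) ∧ ‖φ‖ = ‖ψ‖) ∧
    (∀ 𝒬 : PolyIdeal 𝕜 n, 𝒬.IsMaximal →
      ∀ (P : HomPoly 𝕜 n E) (hP : P ∈ 𝒬.space E),
        ∃ hAB : aronBerner P ∈ 𝒬.space (Bidual 𝕜 E),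
          𝒬.norm E ⟨P, hP⟩ = 𝒬.norm (Bidual 𝕜 E) ⟨aronBerner P, hAB⟩) :=
  ⟨fun _ hα φ => STensorNorm.exists_toPoly_eq_aronBerner hα φ,
    fun _ h𝒬 _ hP => h𝒬.exists_aronBerner_mem hP⟩
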